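/- Let $\mathbb F_q$ be a finite field of characteristic $p$, let $m\ge 2$ with $\gcd(p,m)=1$, let $r\ge 1$ and $\lambda$ be integers with $\gcd(m,r\lambda)=1$, and let $\alpha_1,\dots,\alpha_r\in\mathbb F_q$ be pairwise distinct. Let $F=\mathbb F_q(x,y)$ be the function field defined by $$y^m=\prod_{i=1}^r (x-\alpha_i)^{\lambda},$$ with $x$ transcendental over $\mathbb F_q$. For each $i$ there is exactly one place $P_i$ of $F$ that is a zero of $x-\alpha_i$, and there is exactly one place $P_\infty$ of $F$ that is a pole of $x$. For a place $Q$ of $F$ let $H(Q)$ be the set of integers $s\ge 0$ such that some nonzero $f\in F$ has pole divisor $(f)_\infty=sQ$, and let $G(Q)=\mathbb N_0\setminus H(Q)$, where $\mathbb N_0=\{0,1,2,\dots\}$ and $\mathbb N=\{1,2,\dots\}$. Then, for every $1\le i\le r$ (in particular for $P_1$): 1. $H(P_i)=\left\{\alpha\in\mathbb N_0 : -r\alpha+m(r-1)\left\lceil \frac{\alpha}{m}\right\rceil\le 0\right\}$; 2. $H(P_\infty)=\left\{mk+rj\in\mathbb N_0 : j,k\in\mathbb Z,\ 0\le j\le m-1,\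 k\ge 0\right\}$; 3. $G(P_i)=\left\{mk+j\in\mathbb N : j,k\in\mathbb Z,\ 1\le j\le m-1-\left\lfloor \frac mr\right\rfloor,\ 0\le k\le r-2-\left\lfloor \frac{rj}{m}\right\rfloor\right\}$; 4. $G(P_\infty)=\left\{mk-rj\in\mathbb N : j,k\in\mathbb Z,\ 1\le j\le m-1-\left\lfloor \frac mr\right\rfloor,\ \left\lceil \frac{rj}{m}\right\rceil\le k\le r-1\right\}$. -/

import Mathlib

open scoped WithZero

/-- A place of a function field `F / k`, given by its normalized discrete valuation, written
multiplicatively: a surjective valuation onto `ℤᵐ⁰ = {0} ∪ {exp n : n ∈ ℤ}` that is trivial on the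
constants. In a function field of one variable every valuation ring `O` with `k ⊊ O ⊊ F` is a
discrete valuation ring, so that these valuations correspond bijectively to the places of `F / k`. -/
@[ext]
structure Place (k F : Type*) [Field k] [Field F] [Algebra k F] where
  /-- the multiplicative valuation of the place -/
  val : Valuation F ℤᵐ⁰
  surjective_val : Function.Surjective val
  val_algebraMap : ∀ a : k, a ≠ 0 → val (algebraMap k F a) = 1

namespace Place

variable {k F : Type*} [Field k] [Field F] [Algebra k F]

/-- The integer `v_P(f)`, for `f ≠ 0`: the order of vanishing of `f` at `P`. It is positive at the
zeros of `f` and negative at the poles of `f` (and it is only used for `f ≠ 0`). -/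
noncomputable def ord (P : Place k F) (f : F) : ℤ := -WithZero.log (P.val f)

/-- `P` is a zero of `f`. -/
def IsZeroOf (P : Place k F) (f : F) : Prop := f ≠ 0 ∧ 0 < P.ord f

/-- `P` is a pole of `f`. -/
def IsPoleOf (P : Place k F) (f : F) : Prop := f ≠ 0 ∧ P.ord f < 0

end Place

/-- The divisors of `F / k`: the free abelian group on the places. -/
abbrev PlaceDivisor (k F : Type*) [Field k] [Field F] [Algebra k F] := Place k F →₀ ℤ

/-- `D` is the divisor of poles `(f)_∞ = ∑_{v_P(f) < 0} (-v_P(f)) P` of the function `f ≠ 0`. -/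
def IsPoleDivisor {k F : Type*} [Field k] [Field F] [Algebra k F]
    (f : F) (D : PlaceDivisor k F) : Prop :=
  ∀ P : Place k F, D P = max (-P.ord f) 0

/-- The Weierstrass semigroup `H(Q)`: the `s ≥ 0` with `(f)_∞ = s Q` for some function `f`. -/
def weierstrassSemigroup {k F : Type*} [Field k] [Field F] [Algebra k F]
    (Q : Place k F) : Set ℕ :=
  {s | ∃ f : F, f ≠ 0 ∧ IsPoleDivisor f (Finsupp.single Q (s : ℤ))}

/-- The Weierstrass gap set `G(Q) = ℕ₀ \ H(Q)`. -/
def weierstrassGaps {k F : Type*} [Field k] [Field F] [Algebra k F]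
    (Q : Place k F) : Set ℕ :=
  (weierstrassSemigroup Q)ᶜ

/-! Since m is prime to λ, a product z of powers of y and f = ∏ (x - α_i) satisfies z^m = f and
still generates F over k(x), so λ may be taken to be 1. Then z has order 1 and x - α_i order m at
P_i, while x and z have orders -m and -r at P_∞.

Everything rests on one principle: in a sum Σ_{j<m} p_j(x) z^j the nonzero terms have pairwise
distinct orders at P_i (incongruent mod m), and also at P_∞ (because r is invertible mod m). Nothing
cancels, and the order of the sum is the least order of a term (`exists_ord_sum_of_isZeroOf`,
`exists_ord_sum_of_isPoleOf`). The same principle gives the degree of F over k(x), total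
ramification and uniqueness of the places.

The second ingredient is `exists_eq_sum_of_regular`: the functions regular away from P_∞ are exactly
such sums. The discriminant of 1, z, …, z^(m-1) is a constant times f^(m-1), so only powers of f can
occur as denominators, and the orders at the P_i exclude those too. Hence the pole orders at P_∞ are
those of the monomials x^l z^j, and those at P_i come from the functions (x - α_i)^e z^j with no
pole at P_∞. The gap sets follow by arithmetic. -/

/-! ### Integer arithmetic of the semigroups and their gaps. -/

theorem ceil_natCast_div_eq {m : ℕ} (hm : 0 < m) (a : ℤ) (c : ℤ) :
    ⌈(a : ℚ) / m⌉ = c ↔ (m : ℤ) * (c - 1) < a ∧ a ≤ m * c := by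
  have hm' : (0 : ℚ) < m := by exact_mod_cast hm
  rw [Int.ceil_eq_iff, lt_div_iff₀ hm', div_le_iff₀ hm']
  rw [mul_comm (m : ℤ), mul_comm (m : ℤ)]
  exact_mod_cast Iff.rfl

theorem ceil_intCast_div_le {m : ℕ} (hm : 0 < m) (a : ℤ) (c : ℤ) :
    ⌈(a : ℚ) / m⌉ ≤ c ↔ a ≤ m * c := by
  have hm' : (0 : ℚ) < m := by exact_mod_cast hm
  rw [Int.ceil_le, div_le_iff₀ hm', mul_comm (m : ℤ)]
  exact_mod_cast Iff.rfl

theorem le_floor_intCast_div {m : ℕ} (hm : 0 < m) (a : ℤ) (c : ℤ) :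
    c ≤ ⌊(a : ℚ) / m⌋ ↔ m * c ≤ a := by
  have hm' : (0 : ℚ) < m := by exact_mod_cast hm
  rw [Int.le_floor, le_div_iff₀ hm', mul_comm (m : ℤ)]
  exact_mod_cast Iff.rfl

/-- Division with remainder a = mc - j, 0 ≤ j < m, makes c = -e the ceiling. The pair (e, j) stands
for (x - α_i)^e z^j, of order me + j at P_i and -(me + rj) at P_∞. -/
theorem mem_affine_semigroup_iff {m r : ℕ} (hm : 0 < m) (a : ℕ) :
    -(r : ℤ) * a + m * ((r : ℤ) - 1) * ⌈(a : ℚ) / m⌉ ≤ 0 ↔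
      ∃ e j : ℤ, 0 ≤ j ∧ j < m ∧ m * e + r * j ≤ 0 ∧ (a : ℤ) = -(m * e + j) := by
  have hc := (ceil_natCast_div_eq hm a _).1 rfl
  rw [Int.cast_natCast] at hc
  constructor
  · intro h
    refine ⟨-⌈(a : ℚ) / m⌉, m * ⌈(a : ℚ) / m⌉ - a, ?_, ?_, ?_, ?_⟩ <;> linarith
  · rintro ⟨e, j, h0, hj, h, ha⟩
    have : ⌈(a : ℚ) / m⌉ = -e := by
      have := (ceil_natCast_div_eq hm a (-e)).2 (by constructor <;> linarith)
      simpa using this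
    rw [this, ha]
    linarith

/-- With l + 1 the ceiling and j = n - ml, being a gap becomes rj < m(r - 1 - l). The bound on j is
the case l = 0 of this inequality, so it only says that the range of l is nonempty. -/
theorem affine_gaps_eq {m r : ℕ} (hm : 0 < m) (hr : 0 < r) :
    {a : ℕ | -(r : ℤ) * a + m * ((r : ℤ) - 1) * ⌈(a : ℚ) / m⌉ ≤ 0}ᶜ =
      {n : ℕ | 0 < n ∧ ∃ j l : ℤ, 1 ≤ j ∧ j ≤ (m : ℤ) - 1 - ⌊(m : ℚ) / r⌋ ∧
          0 ≤ l ∧ l ≤ (r : ℤ) - 2 - ⌊(r : ℚ) * j / m⌋ ∧ (n : ℤ) = m * l + j} := by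
  have hm' : (0 : ℤ) < m := by exact_mod_cast hm
  have hr' : (0 : ℤ) < r := by exact_mod_cast hr
  have hl (j l : ℤ) : l ≤ (r : ℤ) - 2 - ⌊(r : ℚ) * j / m⌋ ↔ r * j < m * (r - 1 - l) := by
    have := le_floor_intCast_div hm (r * j) (r - 1 - l)
    push_cast at this ⊢
    rw [← not_le, ← this]
    omega
  have hf (j : ℤ) : j ≤ (m : ℤ) - 1 - ⌊(m : ℚ) / r⌋ ↔ m < r * (m - j) := by
    have := le_floor_intCast_div hr m (m - j)
    push_cast at this ⊢
    rw [← not_le, ← this]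
    omega
  ext n
  simp only [Set.mem_compl_iff, Set.mem_ofPred_eq, not_le, hl, hf]
  have hc := (ceil_natCast_div_eq hm n _).1 rfl
  rw [Int.cast_natCast] at hc
  constructor
  · intro h
    set c := ⌈(n : ℚ) / m⌉ with hcd
    have hn : 0 < n := by
      rcases Nat.eq_zero_or_pos n with rfl | hn
      · simp [hcd] at h
      · exact hn
    have hn' : (0 : ℤ) < n := by exact_mod_cast hn
    have hc1 : 1 ≤ c := by
      by_contra hcc
      nlinarith
    have : 0 ≤ (m : ℤ) * (c - 1) := mul_nonneg hm'.le (by omega)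
    refine ⟨hn, n - m * (c - 1), c - 1, by linarith, by nlinarith, by linarith, by nlinarith,
      by ring⟩
  · rintro ⟨hn, j, l, hj1, hj2, hl0, hl1, hnn⟩
    have hjm : j < m := by nlinarith
    have hce : ⌈(n : ℚ) / m⌉ = l + 1 := by
      have := (ceil_natCast_div_eq hm n (l + 1)).2 (by constructor <;> linarith)
      simpa using this
    rw [hce, hnn]
    nlinarith

/-- By coprimality n = ml - rj for a unique j in [0, m). Rewriting this as m(l - r) + r(m - j) shows
that n is a nongap exactly when j = 0 or l ≥ r. -/
theorem infinity_gaps_eq {m r : ℕ} (hm : 2 ≤ m) (hr : 0 < r) (hmr : Int.gcd m r = 1) :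
    {n : ℕ | ∃ j l : ℤ, 0 ≤ j ∧ j ≤ (m : ℤ) - 1 ∧ 0 ≤ l ∧ (n : ℤ) = m * l + r * j}ᶜ =
      {n : ℕ | 0 < n ∧ ∃ j l : ℤ, 1 ≤ j ∧ j ≤ (m : ℤ) - 1 - ⌊(m : ℚ) / r⌋ ∧
          ⌈(r : ℚ) * j / m⌉ ≤ l ∧ l ≤ (r : ℤ) - 1 ∧ (n : ℤ) = m * l - r * j} := by
  have hm' : (0 : ℤ) < m := by omega
  have hr' : (0 : ℤ) < r := by exact_mod_cast hr
  have hl (j l : ℤ) : ⌈(r : ℚ) * j / m⌉ ≤ l ↔ r * j ≤ m * l := by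
    have := ceil_intCast_div_le (by omega : 0 < m) (r * j) l
    push_cast at this ⊢
    exact this
  have hf (j : ℤ) : j ≤ (m : ℤ) - 1 - ⌊(m : ℚ) / r⌋ ↔ m < r * (m - j) := by
    have := le_floor_intCast_div hr m (m - j)
    push_cast at this ⊢
    rw [← not_le, ← this]
    omega
  have hcop : IsCoprime (m : ℤ) (r : ℤ) := Int.isCoprime_iff_gcd_eq_one.2 hmr
  ext n
  simp only [Set.mem_compl_iff, Set.mem_ofPred_eq, hl, hf]
  constructor
  · intro h
    obtain ⟨s, t, hst⟩ := id hcop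
    -- From sm + tr = 1 one gets n ≡ r(tn) mod m, so j must represent -tn.
    set j := (-(t * n)) % m with hj
    have hj0 : 0 ≤ j := Int.emod_nonneg _ hm'.ne'
    have hjm : j < m := Int.emod_lt_of_pos _ hm'
    obtain ⟨l, hnl⟩ : ∃ l : ℤ, (n : ℤ) = m * l - r * j := by
      refine ⟨s * n - r * (-(t * n) / m), ?_⟩
      have := Int.emod_add_mul_ediv (-(t * n)) m
      rw [← hj] at this
      linear_combination -(n : ℤ) * hst + r * this
    have hjl : r * j ≤ m * l := by omega
    have hj1 : 1 ≤ j := by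
      by_contra hcon
      have hj' : j = 0 := by omega
      rw [hj', mul_zero] at hnl hjl
      exact h ⟨0, l, le_rfl, by omega, nonneg_of_mul_nonneg_right hjl hm', by simpa using hnl⟩
    have hlr : l ≤ r - 1 := by
      by_contra hcon
      exact h ⟨m - j, l - r, by omega, by omega, by omega, by linarith⟩
    refine ⟨?_, j, l, hj1, ?_, hjl, hlr, hnl⟩
    · rcases Nat.eq_zero_or_pos n with rfl | hn
      · exact absurd ⟨0, 0, le_rfl, by omega, le_rfl, by simp⟩ h
      · exact hn
    -- The bounds rj ≤ ml ≤ m(r - 1) give the weak inequality. Equality would make r divide m, hence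
    -- r = 1 and j = 0.
    · have h1 : (m : ℤ) ≤ r * (m - j) := by nlinarith
      refine lt_of_le_of_ne h1 fun heq => ?_
      have hu : IsUnit (r : ℤ) := hcop.isUnit_of_dvd' ⟨_, heq⟩ dvd_rfl
      have : (r : ℤ) = 1 := by
        rcases Int.isUnit_iff.1 hu with h | h <;> omega
      rw [this] at heq
      omega
  · rintro ⟨hn, j, l, hj1, hj2, hjl, hlr, hnl⟩ ⟨j', l', hj0', hjm', hl0', hnl'⟩
    have hjm : j < m := by nlinarith
    have hd : (m : ℤ) ∣ j + j' := by
      refine hcop.dvd_of_dvd_mul_left ⟨l - l', by linarith⟩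
    -- The sum is a multiple of m lying strictly between 0 and 2m. Then l = l' + r, against l ≤ r -
    -- 1.
    have : j + j' = m := by
      obtain ⟨d, hd⟩ := hd
      have h1 : 0 < d := by
        by_contra hcon
        nlinarith
      have h2 : d < 2 := by
        by_contra hcon
        nlinarith
      have : d = 1 := by omega
      rw [hd, this, mul_one]
    have : (m : ℤ) * (l - l' - r) = 0 := by
      have : j = m - j' := by omega
      subst this
      linarith
    rcases mul_eq_zero.1 this with h | h <;> omega

/-! ### Orders of functions, sums and polynomials at a place. -/

namespace Place

variable {k F : Type*} [Field k] [Field F] [Algebra k F] (P : Place k F)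

theorem val_eq_exp_neg_ord {f : F} (hf : f ≠ 0) : P.val f = WithZero.exp (-P.ord f) := by
  rw [ord, neg_neg, WithZero.exp_log ((Valuation.ne_zero_iff _).2 hf)]

theorem val_le_one_iff {f : F} (hf : f ≠ 0) : P.val f ≤ 1 ↔ 0 ≤ P.ord f := by
  rw [P.val_eq_exp_neg_ord hf, ← WithZero.exp_zero, WithZero.exp_le_exp]; omega

theorem val_lt_one_iff {f : F} (hf : f ≠ 0) : P.val f < 1 ↔ 0 < P.ord f := by
  rw [P.val_eq_exp_neg_ord hf, ← WithZero.exp_zero, WithZero.exp_lt_exp]; omega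

theorem val_eq_one_iff {f : F} (hf : f ≠ 0) : P.val f = 1 ↔ P.ord f = 0 := by
  rw [P.val_eq_exp_neg_ord hf, ← WithZero.exp_zero, WithZero.exp_inj]; omega

theorem val_lt_val_iff {f g : F} (hf : f ≠ 0) (hg : g ≠ 0) :
    P.val f < P.val g ↔ P.ord g < P.ord f := by
  rw [P.val_eq_exp_neg_ord hf, P.val_eq_exp_neg_ord hg, WithZero.exp_lt_exp]; omega

theorem val_le_one_of_not_pole {f : F} (hf : ¬ P.IsPoleOf f) : P.val f ≤ 1 := by
  by_cases h0 : f = 0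
  · simp [h0]
  · rw [P.val_le_one_iff h0]
    by_contra h
    exact hf ⟨h0, by omega⟩

@[simp] theorem ord_one : P.ord 1 = 0 := by simp [ord]

theorem ord_mul {f g : F} (hf : f ≠ 0) (hg : g ≠ 0) : P.ord (f * g) = P.ord f + P.ord g := by
  rw [ord, map_mul, WithZero.log_mul ((Valuation.ne_zero_iff _).2 hf)
    ((Valuation.ne_zero_iff _).2 hg), ord, ord]
  ring

@[simp] theorem ord_inv (f : F) : P.ord f⁻¹ = -P.ord f := by
  rw [ord, map_inv₀, WithZero.log_inv, ord]

theorem ord_div {f g : F} (hf : f ≠ 0) (hg : g ≠ 0) : P.ord (f / g) = P.ord f - P.ord g := by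
  rw [div_eq_mul_inv, P.ord_mul hf (inv_ne_zero hg), ord_inv]; ring

@[simp] theorem ord_pow (f : F) (n : ℕ) : P.ord (f ^ n) = n * P.ord f := by
  rw [ord, map_pow, WithZero.log_pow, ord]; simp

@[simp] theorem ord_zpow (f : F) (n : ℤ) : P.ord (f ^ n) = n * P.ord f := by
  rw [ord, map_zpow₀, WithZero.log_zpow, ord]; simp

theorem ord_prod {ι : Type*} (s : Finset ι) (g : ι → F) (h : ∀ i ∈ s, g i ≠ 0) :
    P.ord (∏ i ∈ s, g i) = ∑ i ∈ s, P.ord (g i) := by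
  classical
  induction s using Finset.induction_on with
  | empty => simp
  | insert a s ha ih =>
    rw [Finset.prod_insert ha, Finset.sum_insert ha, P.ord_mul (h a (Finset.mem_insert_self a s))
      (Finset.prod_ne_zero_iff.2 fun i hi => h i (Finset.mem_insert_of_mem hi)),
      ih fun i hi => h i (Finset.mem_insert_of_mem hi)]

theorem val_algebraMap_le_one (a : k) : P.val (algebraMap k F a) ≤ 1 := by
  by_cases h : a = 0
  · simp [h]
  · exact (P.val_algebraMap a h).le

theorem exists_ord_eq_one : ∃ f : F, f ≠ 0 ∧ P.ord f = 1 := by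
  obtain ⟨f, hf⟩ := P.surjective_val (WithZero.exp (-1))
  refine ⟨f, fun h => ?_, by rw [ord, hf]; rfl⟩
  rw [h, map_zero] at hf
  exact WithZero.exp_ne_zero hf.symm

theorem ext_ord {P Q : Place k F} (h : ∀ f : F, f ≠ 0 → P.ord f = Q.ord f) : P = Q := by
  ext f : 2
  by_cases hf : f = 0
  · simp [hf]
  · rw [P.val_eq_exp_neg_ord hf, Q.val_eq_exp_neg_ord hf, h f hf]

/-- A sum of functions whose nonzero terms have pairwise distinct orders has as order the minimum
of the orders of the terms. -/
theorem exists_ord_sum_eq {ι : Type*} (s : Finset ι) (g : ι → F)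
    (hd : ∀ i ∈ s, ∀ j ∈ s, g i ≠ 0 → g j ≠ 0 → P.ord (g i) = P.ord (g j) → i = j)
    (hne : ∃ i ∈ s, g i ≠ 0) :
    ∃ j ∈ s, g j ≠ 0 ∧ ∑ i ∈ s, g i ≠ 0 ∧ P.ord (∑ i ∈ s, g i) = P.ord (g j) ∧
      ∀ i ∈ s, g i ≠ 0 → P.ord (g j) ≤ P.ord (g i) := by
  classical
  obtain ⟨j, hj, hmin⟩ := Finset.exists_min_image (s.filter (g · ≠ 0)) (fun i => P.ord (g i))
    (by obtain ⟨i, hi, h⟩ := hne; exact ⟨i, by simp [hi, h]⟩)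
  simp only [Finset.mem_filter] at hj hmin
  have hval : P.val (∑ i ∈ s, g i) = P.val (g j) := by
    refine Valuation.map_sum_eq_of_lt _ hj.1 fun i hi => ?_
    simp only [Finset.mem_sdiff, Finset.mem_singleton] at hi
    by_cases h0 : g i = 0
    · rw [h0, map_zero]; exact (Valuation.pos_iff _).2 hj.2
    · rw [P.val_lt_val_iff h0 hj.2]
      exact lt_of_le_of_ne (hmin i ⟨hi.1, h0⟩) fun h => hi.2 (hd j hj.1 i hi.1 hj.2 h0 h).symm
  refine ⟨j, hj.1, hj.2, ?_, by rw [ord, hval, ord], fun i hi h0 => hmin i ⟨hi, h0⟩⟩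
  rw [← Valuation.ne_zero_iff P.val, hval, Valuation.ne_zero_iff]
  exact hj.2

open Polynomial

theorem val_aeval_le_one {x : F} (hx : P.val x ≤ 1) (p : k[X]) : P.val (aeval x p) ≤ 1 := by
  rw [aeval_eq_sum_range]
  refine Valuation.map_sum_le _ fun i _ => ?_
  rw [Algebra.smul_def, map_mul, map_pow]
  exact mul_le_one' (P.val_algebraMap_le_one _) (pow_le_one' hx i)

theorem val_aeval_eq_one {x : F} {a : k} (hx : P.val (x - algebraMap k F a) < 1) {p : k[X]}
    (hp : p.eval a ≠ 0) : P.val (aeval x p) = 1 := by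
  have hx1 : P.val x ≤ 1 := by
    have := P.val.map_add_le hx.le (P.val_algebraMap_le_one a)
    simpa using this
  obtain ⟨q, hq⟩ := X_sub_C_dvd_sub_C_eval (a := a) (p := p)
  have h : aeval x p = algebraMap k F (p.eval a) + (x - algebraMap k F a) * aeval x q := by
    have := congrArg (aeval x) hq
    simp only [map_sub, map_mul, aeval_X, aeval_C] at this
    rw [← this]; ring
  rw [h, Valuation.map_add_eq_of_lt_left, P.val_algebraMap _ hp]
  rw [P.val_algebraMap _ hp, map_mul]
  exact mul_lt_one_of_lt_of_le hx (P.val_aeval_le_one hx1 q)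

theorem ord_aeval_of_zero {x : F} {a : k} (hx : P.IsZeroOf (x - algebraMap k F a)) {p : k[X]}
    (hp : p ≠ 0) :
    P.ord (aeval x p) = p.rootMultiplicity a * P.ord (x - algebraMap k F a) := by
  obtain ⟨q, hq, hqa⟩ := exists_eq_pow_rootMultiplicity_mul_and_not_dvd p hp a
  have hv : P.val (aeval x q) = 1 :=
    P.val_aeval_eq_one ((P.val_lt_one_iff hx.1).2 hx.2) (by rwa [dvd_iff_isRoot] at hqa)
  have hq0 : aeval x q ≠ 0 := fun h => by simp [h] at hv
  conv_lhs => rw [hq]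
  rw [map_mul, map_pow, P.ord_mul _ hq0, (P.val_eq_one_iff hq0).1 hv]
  · simp
  · simpa using fun h => absurd h hx.1

/-- Write p(x) = x^(deg p) · p*(1/x) with p* the reversed polynomial. As 1/x vanishes at P and p*(0)
is the leading coefficient of p, the second factor is a unit at P. -/
theorem ord_aeval_of_pole {x : F} (hx : P.IsPoleOf x) {p : k[X]} (hp : p ≠ 0) :
    P.ord (aeval x p) = p.natDegree * P.ord x := by
  let _ := invertibleOfNonzero hx.1
  have h := eval₂_reverse_mul_pow (algebraMap k F) x p
  rw [invOf_eq_inv] at h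
  have hv : P.val (aeval x⁻¹ p.reverse) = 1 := by
    refine P.val_aeval_eq_one (a := 0) ?_ ?_
    · rw [map_zero, sub_zero, P.val_lt_one_iff (inv_ne_zero hx.1), ord_inv]
      have := hx.2
      omega
    · rw [← coeff_zero_eq_eval_zero, coeff_zero_reverse]
      exact leadingCoeff_ne_zero.2 hp
  have hq0 : aeval x⁻¹ p.reverse ≠ 0 := fun h => by simp [h] at hv
  rw [aeval_def] at hv hq0
  rw [aeval_def, ← h, P.ord_mul hq0 (pow_ne_zero _ hx.1), (P.val_eq_one_iff hq0).1 hv, ord_pow,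
    zero_add]

end Place

/-! ### Integral closures, existence of zeros, and radical extensions. -/

open Polynomial IntermediateField

open scoped IntermediateField.algebraAdjoinAdjoin

section

variable {k F : Type*} [Field k] [Field F] [Algebra k F]

/-- The place of `F / k` given by a maximal ideal of a Dedekind domain with fraction field `F`. -/
noncomputable def IsDedekindDomain.HeightOneSpectrum.place (k : Type*) {F B : Type*} [Field k]
    [Field F] [Algebra k F] [CommRing B] [IsDedekindDomain B] [Algebra B F] [IsFractionRing B F]
    [Algebra k B] [IsScalarTower k B F]
    (v : IsDedekindDomain.HeightOneSpectrum B) : Place k F where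
  val := v.valuation F
  surjective_val := v.valuation_surjective F
  val_algebraMap a ha := by
    rw [IsScalarTower.algebraMap_apply k B F, v.valuation_eq_one_iff_notMem]
    exact fun h => v.isPrime.ne_top
      (Ideal.eq_top_of_isUnit_mem _ h ((IsUnit.mk0 a ha).map (algebraMap k B)))

theorem isPrincipalIdealRing_adjoin_singleton {w : F} (hw : Transcendental k w) :
    IsPrincipalIdealRing (Algebra.adjoin k {w}) :=
  let e := (Polynomial.algEquivOfTranscendental k w hw).toRingEquiv
  IsPrincipalIdealRing.of_surjective e.toRingHom e.surjective

section

variable {w : F} [FiniteDimensional k⟮w⟯ F] [Algebra.IsSeparable k⟮w⟯ F]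

theorem isDedekindDomain_integralClosure_adjoin_singleton (hw : Transcendental k w) :
    IsDedekindDomain (integralClosure (Algebra.adjoin k {w}) F) :=
  have := isPrincipalIdealRing_adjoin_singleton hw
  integralClosure.isDedekindDomain (Algebra.adjoin k {w}) k⟮w⟯ F

/-- A function that is regular wherever `w` is regular is integral over `k[w]`. -/
theorem isIntegral_adjoin_of_forall_place (hw : Transcendental k w) {u : F}
    (hu : ∀ P : Place k F, P.val w ≤ 1 → P.val u ≤ 1) : IsIntegral (Algebra.adjoin k {w}) u := by
  have := isDedekindDomain_integralClosure_adjoin_singleton hw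
  have : IsFractionRing (integralClosure (Algebra.adjoin k {w}) F) F :=
    integralClosure.isFractionRing_of_finite_extension k⟮w⟯ F
  obtain ⟨b, rfl⟩ := IsDedekindDomain.HeightOneSpectrum.mem_integers_of_valuation_le_one
    (R := integralClosure (Algebra.adjoin k {w}) F) F u fun v => by
      refine hu (v.place k) ?_
      exact v.valuation_le_one (algebraMap (Algebra.adjoin k {w}) _
        ⟨w, Algebra.subset_adjoin rfl⟩)
  exact b.2

/-- A transcendental function has a zero. -/
theorem exists_place_isZeroOf (hw : Transcendental k w) : ∃ P : Place k F, P.IsZeroOf w := by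
  have := isDedekindDomain_integralClosure_adjoin_singleton hw
  have : IsFractionRing (integralClosure (Algebra.adjoin k {w}) F) F :=
    integralClosure.isFractionRing_of_finite_extension k⟮w⟯ F
  have hw0 : w ≠ 0 := fun h => hw (h ▸ isAlgebraic_zero)
  -- Without zeros of w, the function 1/w is regular everywhere, hence integral over k[w]. This ring
  -- is integrally closed, so 1/w = p(w) for a polynomial p, and X p = 1 fails at 0.
  by_contra! h
  have hint : IsIntegral (Algebra.adjoin k {w}) w⁻¹ := by
    refine isIntegral_adjoin_of_forall_place hw fun P _ => ?_
    rw [P.val_le_one_iff (inv_ne_zero hw0), P.ord_inv]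
    have : ¬ 0 < P.ord w := fun hP => h P ⟨hw0, hP⟩
    omega
  have := isPrincipalIdealRing_adjoin_singleton hw
  have hK : w⁻¹ ∈ k⟮w⟯ := inv_mem (mem_adjoin_simple_self k w)
  have hint' : IsIntegral (Algebra.adjoin k {w}) (⟨w⁻¹, hK⟩ : k⟮w⟯) :=
    (isIntegral_algebraMap_iff (algebraMap k⟮w⟯ F).injective).1 hint
  obtain ⟨c, hc⟩ := IsIntegrallyClosed.isIntegral_iff.1 hint'
  have hc' : (c : F) = w⁻¹ := congrArg (algebraMap k⟮w⟯ F) hc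
  have hcm := c.2
  rw [hc', Algebra.adjoin_singleton_eq_range_aeval] at hcm
  obtain ⟨p, hp⟩ := hcm
  have hp' : aeval w p = w⁻¹ := hp
  rw [transcendental_iff] at hw
  have h1 := hw (X * p - 1) (by simp [hp', mul_inv_cancel₀ hw0])
  have h2 := congrArg (eval 0) h1
  simp at h2

end

section

variable {m : ℕ} {w z : F}

theorem adjoin_radical_eq_top (htop : IntermediateField.adjoin k {w, z} = ⊤) :
    IntermediateField.adjoin k⟮w⟯ {z} = ⊤ := by
  have : (IntermediateField.adjoin k⟮w⟯ {z}).restrictScalars k = ⊤ := by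
    rw [adjoin_simple_adjoin_simple, htop]
  exact IntermediateField.restrictScalars_eq_top_iff.1 this

theorem isIntegral_radical (hm : (m : k) ≠ 0) (hz : z ^ m ∈ k⟮w⟯) : IsIntegral k⟮w⟯ z := by
  have hm0 : m ≠ 0 := by rintro rfl; simp at hm
  exact ⟨X ^ m - C ⟨z ^ m, hz⟩, monic_X_pow_sub_C _ hm0, by simp⟩

theorem finiteDimensional_radical (hm : (m : k) ≠ 0) (hz : z ^ m ∈ k⟮w⟯)
    (htop : IntermediateField.adjoin k {w, z} = ⊤) : FiniteDimensional k⟮w⟯ F := by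
  have h := IntermediateField.adjoin.finiteDimensional (isIntegral_radical hm hz)
  rw [adjoin_radical_eq_top htop] at h
  exact Module.Finite.equiv (IntermediateField.topEquiv (F := k⟮w⟯) (E := F)).toLinearEquiv

theorem isSeparable_radical (hm : (m : k) ≠ 0) (hz0 : z ≠ 0) (hz : z ^ m ∈ k⟮w⟯)
    (htop : IntermediateField.adjoin k {w, z} = ⊤) : Algebra.IsSeparable k⟮w⟯ F := by
  have hsep : IsSeparable k⟮w⟯ z := by
    have : (X ^ m - C (⟨z ^ m, hz⟩ : k⟮w⟯)).Separable := by
      refine separable_X_pow_sub_C _ ?_ ?_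
      · intro h
        rw [← map_natCast (algebraMap k k⟮w⟯)] at h
        exact hm ((map_eq_zero _).1 h)
      · intro h
        exact pow_ne_zero m hz0 (congrArg (algebraMap k⟮w⟯ F) h)
    refine this.of_dvd (minpoly.dvd _ _ ?_)
    simp
  have h := (isSeparable_adjoin_simple_iff_isSeparable k⟮w⟯ F).2 hsep
  rw [adjoin_radical_eq_top htop] at h
  exact AlgEquiv.Algebra.isSeparable (IntermediateField.topEquiv (F := k⟮w⟯) (E := F))

end

end

/-! ### The equation z^m = ∏ (x - α_i) and orders at zeros of x - α_i and poles of x. -/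

/-- `F = k(x, z)` with `z ^ m = ∏ i, (x - α i)`, where the `α i` are pairwise distinct and `m` is
prime to their number and to the characteristic of `k`. -/
structure IsSuperelliptic {k F : Type*} [Field k] [Field F] [Algebra k F] {r : ℕ} (m : ℕ)
    (α : Fin r → k) (x z : F) : Prop where
  two_le : 2 ≤ m
  cast_ne_zero : (m : k) ≠ 0
  gcd_eq_one : Int.gcd m r = 1
  injective : Function.Injective α
  transcendental : Transcendental k x
  pow_eq : z ^ m = ∏ i, (x - algebraMap k F (α i))
  adjoin_eq_top : IntermediateField.adjoin k {x, z} = ⊤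

theorem Transcendental.sub_algebraMap {k F : Type*} [Field k] [Field F] [Algebra k F] {x : F}
    (hx : Transcendental k x) (a : k) : Transcendental k (x - algebraMap k F a) :=
  fun h => hx (by simpa using h.add (isAlgebraic_algebraMap a))

theorem Int.eq_of_mul_add_eq_mul_add {m a b : ℤ} {i j : ℕ} (hi : (i : ℤ) < m)
    (hj : (j : ℤ) < m) (he : m * a + i = m * b + j) : i = j := by
  have h1 := Int.emod_eq_of_lt (by omega : 0 ≤ (i : ℤ)) hi
  have h2 := Int.emod_eq_of_lt (by omega : 0 ≤ (j : ℤ)) hj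
  have h3 := congrArg (· % m) he
  simp only [Int.mul_add_emod_self_left, h1, h2] at h3
  exact_mod_cast h3

/-- The radicand as an element of `k(x)`. -/
noncomputable def radicand (k : Type*) {F : Type*} [Field k] [Field F] [Algebra k F] {r : ℕ}
    (α : Fin r → k) (x : F) : k⟮x⟯ :=
  ∏ i, (AdjoinSimple.gen k x - algebraMap k k⟮x⟯ (α i))

namespace Place

variable {k F : Type*} [Field k] [Field F] [Algebra k F] (P : Place k F)

theorem not_isPoleOf_of_isZeroOf {x : F} {a : k} (hP : P.IsZeroOf (x - algebraMap k F a)) :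
    ¬ P.IsPoleOf x := fun hx => by
  have h1 := P.ord_aeval_of_pole hx (X_sub_C_ne_zero a)
  have h2 := hP.2
  have h3 := hx.2
  simp at h1
  omega

theorem ord_sub_of_isPoleOf {x : F} (hP : P.IsPoleOf x) (a : k) :
    P.ord (x - algebraMap k F a) = P.ord x := by
  simpa using P.ord_aeval_of_pole hP (X_sub_C_ne_zero a)

end Place

namespace IsSuperelliptic

variable {k F : Type*} [Field k] [Field F] [Algebra k F] {m r : ℕ} {α : Fin r → k} {x z : F}
  (h : IsSuperelliptic m α x z) {P : Place k F}
include h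

theorem r_pos : 0 < r := by
  rcases Nat.eq_zero_or_pos r with rfl | hr
  · have h1 := h.gcd_eq_one
    have h2 := h.two_le
    simp at h1
    omega
  · exact hr

theorem m_pos : (0 : ℤ) < m := by have := h.two_le; omega

theorem isCoprime : IsCoprime (m : ℤ) (r : ℤ) := Int.isCoprime_iff_gcd_eq_one.2 h.gcd_eq_one

theorem aeval_ne_zero {p : k[X]} (hp : p ≠ 0) : aeval x p ≠ 0 :=
  fun h0 => hp (transcendental_iff.1 h.transcendental p h0)

theorem x_sub_ne_zero (a : k) : x - algebraMap k F a ≠ 0 :=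
  fun h0 => h.transcendental.sub_algebraMap a (h0 ▸ isAlgebraic_zero)

theorem x_ne_zero : x ≠ 0 := by simpa using h.x_sub_ne_zero 0

theorem z_ne_zero : z ≠ 0 := by
  have h1 : z ^ m ≠ 0 := by
    rw [h.pow_eq]
    exact Finset.prod_ne_zero_iff.2 fun i _ => h.x_sub_ne_zero _
  rintro rfl
  exact h1 (zero_pow (by have := h.two_le; omega))

theorem z_pow_mem {w : F} (hxw : x ∈ k⟮w⟯) : z ^ m ∈ k⟮w⟯ := by
  rw [h.pow_eq]
  exact prod_mem fun i _ => sub_mem hxw (IntermediateField.algebraMap_mem _ _)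

theorem adjoin_eq_top_of_mem {w : F} (hxw : x ∈ k⟮w⟯) :
    IntermediateField.adjoin k {w, z} = ⊤ := by
  rw [eq_top_iff, ← h.adjoin_eq_top, adjoin_le_iff]
  rintro _ (rfl | rfl)
  · exact adjoin.mono k {w} {w, z} (by simp) hxw
  · exact subset_adjoin k _ (by simp)

theorem finiteDimensional : FiniteDimensional k⟮x⟯ F :=
  finiteDimensional_radical h.cast_ne_zero (h.z_pow_mem (mem_adjoin_simple_self k x))
    h.adjoin_eq_top

theorem isSeparable : Algebra.IsSeparable k⟮x⟯ F :=
  isSeparable_radical h.cast_ne_zero h.z_ne_zero (h.z_pow_mem (mem_adjoin_simple_self k x))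
    h.adjoin_eq_top

/-- Applied to w = x - a and to w = 1/x, which produces zeros of x - a and poles of x. -/
theorem exists_isZeroOf {w : F} (hw : Transcendental k w) (hxw : x ∈ k⟮w⟯) :
    ∃ P : Place k F, P.IsZeroOf w := by
  have := finiteDimensional_radical h.cast_ne_zero (h.z_pow_mem hxw) (h.adjoin_eq_top_of_mem hxw)
  have := isSeparable_radical h.cast_ne_zero h.z_ne_zero (h.z_pow_mem hxw)
    (h.adjoin_eq_top_of_mem hxw)
  exact exists_place_isZeroOf hw

theorem exists_isZeroOf_sub (a : k) : ∃ P : Place k F, P.IsZeroOf (x - algebraMap k F a) := by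
  refine h.exists_isZeroOf (h.transcendental.sub_algebraMap a) ?_
  have := add_mem (mem_adjoin_simple_self k (x - algebraMap k F a)) (IntermediateField.algebraMap_mem _ a)
  rwa [sub_add_cancel] at this

theorem exists_isPoleOf : ∃ P : Place k F, P.IsPoleOf x := by
  obtain ⟨P, hP⟩ := h.exists_isZeroOf (w := x⁻¹)
    (fun h' => h.transcendental (by simpa using h'.inv))
    (by simpa using inv_mem (mem_adjoin_simple_self k x⁻¹))
  refine ⟨P, h.x_ne_zero, ?_⟩
  have := hP.2
  rw [P.ord_inv] at this
  omega

theorem ord_sub_nonneg (hP : ¬ P.IsPoleOf x) (a : k) : 0 ≤ P.ord (x - algebraMap k F a) := by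
  have := P.val_aeval_le_one (P.val_le_one_of_not_pole hP) (X - C a)
  rw [← P.val_le_one_iff (h.x_sub_ne_zero a)]
  simpa using this

theorem mul_ord_z : m * P.ord z = ∑ i, P.ord (x - algebraMap k F (α i)) := by
  rw [← P.ord_pow, h.pow_eq, P.ord_prod _ _ fun i _ => h.x_sub_ne_zero _]

theorem ord_z_nonneg (hP : ¬ P.IsPoleOf x) : 0 ≤ P.ord z := by
  have h1 : 0 ≤ (m : ℤ) * P.ord z := by
    rw [h.mul_ord_z]
    exact Finset.sum_nonneg fun i _ => h.ord_sub_nonneg hP _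
  exact nonneg_of_mul_nonneg_right h1 h.m_pos

theorem ord_sub_eq_of_isZeroOf {i : Fin r} (hP : P.IsZeroOf (x - algebraMap k F (α i))) :
    P.ord (x - algebraMap k F (α i)) = m * P.ord z := by
  rw [h.mul_ord_z, Finset.sum_eq_single i]
  · intro j _ hj
    have h1 := P.ord_aeval_of_zero hP (X_sub_C_ne_zero (α j))
    classical
    rw [rootMultiplicity_X_sub_C, if_neg fun e => hj (h.injective e.symm)] at h1
    simpa using h1
  · simp

theorem ord_z_pos_of_isZeroOf {i : Fin r} (hP : P.IsZeroOf (x - algebraMap k F (α i))) :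
    0 < P.ord z := by
  have := hP.2
  rw [h.ord_sub_eq_of_isZeroOf hP] at this
  exact pos_of_mul_pos_right this h.m_pos.le

/-- All factors x - α_i have the order of x at a pole, so m · ord z = r · ord x and coprimality
gives t. That t = 1 is only known once every order at P is seen to be a multiple of t. -/
theorem exists_ord_of_isPoleOf (hP : P.IsPoleOf x) :
    ∃ t : ℤ, 0 < t ∧ P.ord x = -(m * t) ∧ P.ord z = -(r * t) := by
  have h1 := h.mul_ord_z (P := P)
  simp only [P.ord_sub_of_isPoleOf hP, Finset.sum_const, Finset.card_univ, Fintype.card_fin,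
    nsmul_eq_mul] at h1
  obtain ⟨t, ht⟩ := h.isCoprime.dvd_of_dvd_mul_left ⟨_, h1.symm⟩
  refine ⟨-t, ?_, by rw [ht]; ring, ?_⟩
  · have := hP.2
    rw [ht] at this
    by_contra hcon
    have := mul_nonneg h.m_pos.le (by omega : 0 ≤ t)
    omega
  · refine mul_left_cancel₀ h.m_pos.ne' ?_
    rw [h1, ht]; ring

theorem ord_term_of_isZeroOf {i : Fin r} (hP : P.IsZeroOf (x - algebraMap k F (α i))) {p : k[X]}
    (hp : p ≠ 0) (j : ℕ) :
    P.ord (aeval x p * z ^ j) = (m * p.rootMultiplicity (α i) + j) * P.ord z := by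
  rw [P.ord_mul (h.aeval_ne_zero hp) (pow_ne_zero _ h.z_ne_zero), P.ord_aeval_of_zero hP hp,
    h.ord_sub_eq_of_isZeroOf hP, P.ord_pow]
  ring

theorem ord_term_of_isPoleOf (hP : P.IsPoleOf x) {t : ℤ} (htx : P.ord x = -(m * t))
    (htz : P.ord z = -(r * t)) {p : k[X]} (hp : p ≠ 0) (j : ℕ) :
    P.ord (aeval x p * z ^ j) = -((m * p.natDegree + r * j) * t) := by
  rw [P.ord_mul (h.aeval_ne_zero hp) (pow_ne_zero _ h.z_ne_zero), P.ord_aeval_of_pole hP hp,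
    P.ord_pow, htx, htz]
  ring

theorem term_ne_zero_iff {p : k[X]} {j : ℕ} : aeval x p * z ^ j ≠ 0 ↔ p ≠ 0 := by
  constructor
  · rintro h1 rfl
    simp at h1
  · exact fun hp => mul_ne_zero (h.aeval_ne_zero hp) (pow_ne_zero _ h.z_ne_zero)

/-- In units of ord z the nonzero terms have orders congruent to their index mod m, so no two agree.
The minimality clause does not involve P, which later allows two zeros of x - α_i to be compared. -/
theorem exists_ord_sum_of_isZeroOf {i : Fin r} (hP : P.IsZeroOf (x - algebraMap k F (α i)))
    (p : ℕ → k[X]) (hp : ∃ j < m, p j ≠ 0) :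
    ∃ j < m, p j ≠ 0 ∧ ∑ l ∈ Finset.range m, aeval x (p l) * z ^ l ≠ 0 ∧
      P.ord (∑ l ∈ Finset.range m, aeval x (p l) * z ^ l) =
        (m * (p j).rootMultiplicity (α i) + j) * P.ord z ∧
      ∀ l < m, p l ≠ 0 → m * (p j).rootMultiplicity (α i) + j ≤
        m * (p l).rootMultiplicity (α i) + l := by
  have hz := h.ord_z_pos_of_isZeroOf hP
  obtain ⟨j, hj, hj0, hs, ho, hmin⟩ := P.exists_ord_sum_eq (Finset.range m)
    (fun l => aeval x (p l) * z ^ l) (by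
      intro l hl l' hl' h0 h0' he
      rw [h.ord_term_of_isZeroOf hP (h.term_ne_zero_iff.1 h0),
        h.ord_term_of_isZeroOf hP (h.term_ne_zero_iff.1 h0')] at he
      rw [Finset.mem_range] at hl hl'
      exact Int.eq_of_mul_add_eq_mul_add (by omega) (by omega) (mul_right_cancel₀ hz.ne' he))
    (by
      obtain ⟨j, hj, hj0⟩ := hp
      exact ⟨j, Finset.mem_range.2 hj, h.term_ne_zero_iff.2 hj0⟩)
  rw [h.term_ne_zero_iff] at hj0
  refine ⟨j, Finset.mem_range.1 hj, hj0, hs, by rw [ho, h.ord_term_of_isZeroOf hP hj0],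
    fun l hl hl0 => ?_⟩
  have := hmin l (Finset.mem_range.2 hl) (h.term_ne_zero_iff.2 hl0)
  rw [h.ord_term_of_isZeroOf hP hj0, h.ord_term_of_isZeroOf hP hl0] at this
  exact_mod_cast le_of_mul_le_mul_right this hz

/-- In units of t the pole orders m · deg + rl are distinct mod m, because r is invertible mod m and
l < m. -/
theorem exists_ord_sum_of_isPoleOf (hP : P.IsPoleOf x) {t : ℤ} (ht : 0 < t)
    (htx : P.ord x = -(m * t)) (htz : P.ord z = -(r * t))
    (p : ℕ → k[X]) (hp : ∃ j < m, p j ≠ 0) :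
    ∃ j < m, p j ≠ 0 ∧
      P.ord (∑ l ∈ Finset.range m, aeval x (p l) * z ^ l) =
        -((m * (p j).natDegree + r * j) * t) ∧
      ∀ l < m, p l ≠ 0 → m * (p l).natDegree + r * l ≤ m * (p j).natDegree + r * j := by
  obtain ⟨j, hj, hj0, -, ho, hmin⟩ := P.exists_ord_sum_eq (Finset.range m)
    (fun l => aeval x (p l) * z ^ l) (by
      intro l hl l' hl' h0 h0' he
      rw [h.ord_term_of_isPoleOf hP htx htz (h.term_ne_zero_iff.1 h0),
        h.ord_term_of_isPoleOf hP htx htz (h.term_ne_zero_iff.1 h0')] at he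
      rw [Finset.mem_range] at hl hl'
      have he := mul_right_cancel₀ ht.ne' (neg_injective he)
      have hd : (m : ℤ) ∣ l - l' := h.isCoprime.dvd_of_dvd_mul_left
        ⟨(p l').natDegree - (p l).natDegree, by linear_combination he⟩
      obtain ⟨d, hd⟩ := hd
      exact Int.eq_of_mul_add_eq_mul_add (m := m) (a := 0) (b := d)
        (by omega) (by omega) (by linear_combination hd))
    (by
      obtain ⟨j, hj, hj0⟩ := hp
      exact ⟨j, Finset.mem_range.2 hj, h.term_ne_zero_iff.2 hj0⟩)
  rw [h.term_ne_zero_iff] at hj0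
  refine ⟨j, Finset.mem_range.1 hj, hj0, by rw [ho, h.ord_term_of_isPoleOf hP htx htz hj0],
    fun l hl hl0 => ?_⟩
  have := hmin l (Finset.mem_range.2 hl) (h.term_ne_zero_iff.2 hl0)
  rw [h.ord_term_of_isPoleOf hP htx htz hj0, h.ord_term_of_isPoleOf hP htx htz hl0,
    neg_le_neg_iff] at this
  exact_mod_cast le_of_mul_le_mul_right this ht

/-- At a zero of x - α_0, nonzero elements of k(x) have order in m · ord z · ℤ. The terms c_j z^j
with j < m therefore have distinct orders, and no nontrivial relation of degree below m can hold. -/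
theorem minpoly_z : minpoly k⟮x⟯ z = X ^ m - C (radicand k α x) := by
  have hm0 : m ≠ 0 := by have := h.two_le; omega
  have hroot : aeval z (X ^ m - C (radicand k α x)) = 0 := by
    simp [radicand, h.pow_eq]
  have hint : IsIntegral k⟮x⟯ z := ⟨_, monic_X_pow_sub_C _ hm0, hroot⟩
  refine (eq_of_monic_of_dvd_of_natDegree_le (minpoly.monic hint) (monic_X_pow_sub_C _ hm0)
    (minpoly.dvd _ _ hroot) ?_).symm
  rw [natDegree_X_pow_sub_C]
  by_contra! hlt
  obtain ⟨P, hP⟩ := h.exists_isZeroOf_sub (α ⟨0, h.r_pos⟩)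
  have hz := h.ord_z_pos_of_isZeroOf hP
  have hK (c : k⟮x⟯) (hc : (c : F) ≠ 0) : ∃ n : ℤ, P.ord (c : F) = m * n * P.ord z := by
    obtain ⟨p, q, hpq⟩ := (mem_adjoin_simple_iff k _).1 c.2
    have hp : p ≠ 0 := by rintro rfl; simp [hpq] at hc
    have hq : q ≠ 0 := by rintro rfl; simp [hpq] at hc
    refine ⟨p.rootMultiplicity (α ⟨0, h.r_pos⟩) - q.rootMultiplicity (α ⟨0, h.r_pos⟩), ?_⟩
    rw [hpq, P.ord_div (h.aeval_ne_zero hp) (h.aeval_ne_zero hq), P.ord_aeval_of_zero hP hp,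
      P.ord_aeval_of_zero hP hq, h.ord_sub_eq_of_isZeroOf hP]
    ring
  set g := minpoly k⟮x⟯ z
  have h0 : ∑ j ∈ Finset.range m, (g.coeff j : F) * z ^ j = 0 := by
    have h1 := minpoly.aeval k⟮x⟯ z
    rw [aeval_eq_sum_range' hlt] at h1
    simp only [Algebra.smul_def] at h1
    exact h1
  obtain ⟨j, -, -, hs, -⟩ := P.exists_ord_sum_eq (Finset.range m)
    (fun j => (g.coeff j : F) * z ^ j) (by
      intro l hl l' hl' hl0 hl0' he
      rw [Finset.mem_range] at hl hl'
      have c0 := left_ne_zero_of_mul hl0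
      have c0' := left_ne_zero_of_mul hl0'
      obtain ⟨n, hn⟩ := hK _ c0
      obtain ⟨n', hn'⟩ := hK _ c0'
      rw [P.ord_mul c0 (pow_ne_zero _ h.z_ne_zero), P.ord_mul c0' (pow_ne_zero _ h.z_ne_zero),
        hn, hn', P.ord_pow, P.ord_pow, ← add_mul, ← add_mul] at he
      exact Int.eq_of_mul_add_eq_mul_add (by omega) (by omega) (mul_right_cancel₀ hz.ne' he))
    ⟨g.natDegree, Finset.mem_range.2 hlt, mul_ne_zero (by
      rw [coeff_natDegree, (minpoly.monic hint).leadingCoeff]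
      simp) (pow_ne_zero _ h.z_ne_zero)⟩
  exact hs h0

end IsSuperelliptic

/-! ### The discriminant and the functions integral over k[x]. -/

theorem Algebra.exists_aeval_eq_of_adjoin_singleton {k F : Type*} [Field k] [Field F] [Algebra k F]
    {x : F} (y : Algebra.adjoin k {x}) : ∃ q : k[X], aeval x q = (y : F) := by
  obtain ⟨y, hy⟩ := y
  rw [Algebra.adjoin_singleton_eq_range_aeval] at hy
  exact hy

theorem Algebra.exists_sum_of_mem_adjoin_radical {R A : Type*} [CommRing R] [Nontrivial R]
    [CommRing A] [Algebra R A] {m : ℕ} (hm : m ≠ 0) {f : R} {z : A} (hz : z ^ m = algebraMap R A f)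
    {y : A} (hy : y ∈ Algebra.adjoin R {z}) :
    ∃ c : ℕ → R, y = ∑ j ∈ Finset.range m, algebraMap R A (c j) * z ^ j := by
  rw [Algebra.adjoin_singleton_eq_range_aeval] at hy
  obtain ⟨g, rfl⟩ := hy
  have hmon := monic_X_pow_sub_C f hm
  have hdeg : (X ^ m - C f).natDegree = m := natDegree_X_pow_sub_C
  have hlt : (g %ₘ (X ^ m - C f)).natDegree < m := by
    refine (natDegree_modByMonic_lt _ hmon fun h1 => hm ?_).trans_eq hdeg
    rw [← hdeg, h1, natDegree_one]
  refine ⟨fun j => (g %ₘ (X ^ m - C f)).coeff j, ?_⟩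
  change aeval z g = _
  rw [← aeval_modByMonic_eq_self_of_root (q := X ^ m - C f) (by simp [hz]),
    aeval_eq_sum_range' hlt]
  simp only [Algebra.smul_def]

namespace IsSuperelliptic

variable {k F : Type*} [Field k] [Field F] [Algebra k F] {m r : ℕ} {α : Fin r → k} {x z : F}
  (h : IsSuperelliptic m α x z) {P : Place k F}
include h

/-- Up to sign the discriminant is the norm of m z^(m-1), the derivative of X^m - f at z, and the
norm of z is ±f. The constant is nonzero because m ≠ 0 in k. -/
theorem discr_eq (pb : PowerBasis k⟮x⟯ F) (hpb : pb.gen = z) :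
    ∃ c : k, c ≠ 0 ∧
      Algebra.discr k⟮x⟯ pb.basis = algebraMap k k⟮x⟯ c * radicand k α x ^ (m - 1) := by
  have := h.finiteDimensional
  have := h.isSeparable
  have hm2 := h.two_le
  refine ⟨(-1) ^ (pb.dim * (pb.dim - 1) / 2) * ((m : k) ^ pb.dim * ((-1) ^ pb.dim * -1) ^ (m - 1)),
    ?_, ?_⟩
  · have h1 := h.cast_ne_zero
    simp [h1]
  · rw [Algebra.discr_powerBasis_eq_norm]
    have hd : aeval pb.gen (minpoly k⟮x⟯ pb.gen).derivative =
        algebraMap k⟮x⟯ F m * pb.gen ^ (m - 1) := by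
      rw [hpb, h.minpoly_z, derivative_sub, derivative_X_pow, derivative_C, sub_zero]
      simp
    rw [hd, map_mul, map_pow, Algebra.norm_algebraMap, pb.finrank,
      Algebra.PowerBasis.norm_gen_eq_coeff_zero_minpoly, hpb, h.minpoly_z]
    have hm0 : 0 ≠ m := by omega
    simp only [coeff_sub, coeff_X_pow, hm0, if_false, coeff_C_zero, map_mul, map_pow, map_neg,
      map_one, map_natCast]
    ring

/-- A function that is integral over `k[x]` is a combination of powers of `z`, with
denominators powers of the radicand. -/
theorem exists_sum_of_isIntegral {u : F} (hu : IsIntegral (Algebra.adjoin k {x}) u) :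
    ∃ p : ℕ → k[X], (∏ i, (x - algebraMap k F (α i))) ^ (m - 1) * u =
      ∑ j ∈ Finset.range m, aeval x (p j) * z ^ j := by
  have := h.finiteDimensional
  have := h.isSeparable
  have := isPrincipalIdealRing_adjoin_singleton h.transcendental
  have hm0 : m ≠ 0 := by have := h.two_le; omega
  have hintK : IsIntegral k⟮x⟯ z := Algebra.IsIntegral.isIntegral z
  have htop : Algebra.adjoin k⟮x⟯ {z} = ⊤ := by
    rw [← adjoin_simple_toSubalgebra_of_isAlgebraic hintK.isAlgebraic,
      adjoin_radical_eq_top h.adjoin_eq_top, top_toSubalgebra]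
  obtain ⟨c, hc, hd⟩ := h.discr_eq (PowerBasis.ofAdjoinEqTop hintK htop) rfl
  set R := Algebra.adjoin k {x} with hR
  have hfR : ∏ i, (x - algebraMap k F (α i)) ∈ R := prod_mem fun i _ =>
    sub_mem (Algebra.subset_adjoin rfl) (Subalgebra.algebraMap_mem _ _)
  obtain ⟨f, hf⟩ : ∃ f : R, algebraMap R F f = ∏ i, (x - algebraMap k F (α i)) := ⟨⟨_, hfR⟩, rfl⟩
  have hzm : z ^ m = algebraMap R F f := by rw [hf, h.pow_eq]
  have hz : IsIntegral R z := ⟨_, monic_X_pow_sub_C f hm0, by simp [hzm]⟩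
  -- The discriminant of a power basis with integral generator z carries every integral element into
  -- k[x][z].
  have hmem := Algebra.discr_mul_isIntegral_mem_adjoin (R := R) k⟮x⟯
    (B := PowerBasis.ofAdjoinEqTop hintK htop) hz hu
  rw [hd, PowerBasis.ofAdjoinEqTop_gen] at hmem
  obtain ⟨g, hg⟩ := Algebra.exists_sum_of_mem_adjoin_radical hm0 hzm hmem
  choose q hq using Algebra.exists_aeval_eq_of_adjoin_singleton (k := k) (x := x)
  refine ⟨fun j => C c⁻¹ * q (g j), ?_⟩
  simp only [map_mul, aeval_C, hq, mul_assoc, ← Finset.mul_sum]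
  have hc' : algebraMap k F c ≠ 0 := by simpa using hc
  rw [map_inv₀, eq_inv_mul_iff_mul_eq₀ hc']
  refine Eq.trans ?_ hg
  rw [Algebra.smul_def, map_mul, map_pow, ← mul_assoc]
  congr 2
  simp [radicand]

end IsSuperelliptic

/-! ### Total ramification, uniqueness of the places, and regular functions. -/

namespace IsSuperelliptic

variable {k F : Type*} [Field k] [Field F] [Algebra k F] {m r : ℕ} {α : Fin r → k} {x z : F}
  (h : IsSuperelliptic m α x z) {P : Place k F}
include h

theorem prod_ne_zero : ∏ i, (x - algebraMap k F (α i)) ≠ 0 :=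
  Finset.prod_ne_zero_iff.2 fun i _ => h.x_sub_ne_zero (α i)

theorem exists_mul_eq_sum (u : F) : ∃ (q : k[X]) (p : ℕ → k[X]), q ≠ 0 ∧
    aeval x q * u = ∑ j ∈ Finset.range m, aeval x (p j) * z ^ j := by
  have := h.finiteDimensional
  have hu : IsAlgebraic (Algebra.adjoin k {x}) u :=
    (IsFractionRing.isAlgebraic_iff (Algebra.adjoin k {x}) k⟮x⟯ F).2
      (Algebra.IsAlgebraic.isAlgebraic u)
  obtain ⟨y, hy0, hy⟩ := hu.exists_integral_multiple
  have hyF : (y : F) ≠ 0 := fun h0 => hy0 (Subtype.ext h0)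
  obtain ⟨q, hq⟩ := Algebra.exists_aeval_eq_of_adjoin_singleton y
  obtain ⟨p, hp⟩ := h.exists_sum_of_isIntegral hy
  have hprod : aeval x (∏ i, (X - C (α i))) = ∏ i, (x - algebraMap k F (α i)) := by simp
  refine ⟨(∏ i, (X - C (α i))) ^ (m - 1) * q, p, ?_, ?_⟩
  · refine mul_ne_zero (pow_ne_zero _ ?_) ?_
    · intro h0
      rw [h0, map_zero] at hprod
      exact h.prod_ne_zero hprod.symm
    · rintro rfl
      exact hyF (by rw [← hq, map_zero])
  · rw [← hp, map_mul, map_pow, hprod, hq, Algebra.smul_def, mul_assoc]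
    rfl

omit h in
theorem exists_ne_zero_of_sum_ne_zero {p : ℕ → k[X]}
    (hp : ∑ j ∈ Finset.range m, aeval x (p j) * z ^ j ≠ 0) : ∃ j < m, p j ≠ 0 := by
  by_contra! h0
  exact hp (Finset.sum_eq_zero fun j hj => by simp [h0 j (Finset.mem_range.1 hj)])

/-- After clearing denominators, the order of u in units of ord z is read off from root
multiplicities alone, so n is common to all zeros of x - α_i. As some function has order 1, this
forces ord z = 1, and then any two such zeros have the same valuation. -/
theorem exists_ord_eq_of_isZeroOf (i : Fin r) {u : F} (hu : u ≠ 0) : ∃ n : ℤ, ∀ P : Place k F,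
    P.IsZeroOf (x - algebraMap k F (α i)) → P.ord u = n * P.ord z := by
  obtain ⟨q, p, hq, hp⟩ := h.exists_mul_eq_sum u
  have hp0 := exists_ne_zero_of_sum_ne_zero (hp ▸ mul_ne_zero (h.aeval_ne_zero hq) hu)
  obtain ⟨P₀, hP₀⟩ := h.exists_isZeroOf_sub (α i)
  obtain ⟨j, hj, hj0, -, -, hmin⟩ := h.exists_ord_sum_of_isZeroOf hP₀ p hp0
  refine ⟨m * (p j).rootMultiplicity (α i) + j - m * q.rootMultiplicity (α i), fun P hP => ?_⟩
  obtain ⟨l, hl, hl0, -, ho, hmin'⟩ := h.exists_ord_sum_of_isZeroOf hP p hp0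
  have heq : ((m * (p l).rootMultiplicity (α i) + l : ℕ) : ℤ) =
      (m * (p j).rootMultiplicity (α i) + j : ℕ) :=
    congrArg _ (le_antisymm (hmin' j hj hj0) (hmin l hl hl0))
  push_cast at heq
  rw [← hp, P.ord_mul (h.aeval_ne_zero hq) hu, P.ord_aeval_of_zero hP hq,
    h.ord_sub_eq_of_isZeroOf hP] at ho
  linear_combination ho + P.ord z * heq

theorem ord_z_eq_one {i : Fin r} (hP : P.IsZeroOf (x - algebraMap k F (α i))) : P.ord z = 1 := by
  obtain ⟨u, hu, hu1⟩ := P.exists_ord_eq_one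
  obtain ⟨n, hn⟩ := h.exists_ord_eq_of_isZeroOf i hu
  have h1 := hn P hP
  rw [hu1] at h1
  exact Int.eq_one_of_dvd_one (h.ord_z_pos_of_isZeroOf hP).le ⟨n, by rw [h1]; ring⟩

theorem eq_of_isZeroOf {i : Fin r} {Q : Place k F} (hP : P.IsZeroOf (x - algebraMap k F (α i)))
    (hQ : Q.IsZeroOf (x - algebraMap k F (α i))) : P = Q := by
  refine Place.ext_ord fun u hu => ?_
  obtain ⟨n, hn⟩ := h.exists_ord_eq_of_isZeroOf i hu
  rw [hn P hP, hn Q hQ, h.ord_z_eq_one hP, h.ord_z_eq_one hQ]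

theorem exists_ord_eq_of_isPoleOf {u : F} (hu : u ≠ 0) : ∃ n : ℤ, ∀ P : Place k F,
    P.IsPoleOf x → ∀ t : ℤ, 0 < t → P.ord x = -(m * t) → P.ord z = -(r * t) →
      P.ord u = n * t := by
  obtain ⟨q, p, hq, hp⟩ := h.exists_mul_eq_sum u
  have hp0 := exists_ne_zero_of_sum_ne_zero (hp ▸ mul_ne_zero (h.aeval_ne_zero hq) hu)
  obtain ⟨P₀, hP₀⟩ := h.exists_isPoleOf
  obtain ⟨t₀, ht₀, htx₀, htz₀⟩ := h.exists_ord_of_isPoleOf hP₀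
  obtain ⟨j, hj, hj0, -, hmin⟩ := h.exists_ord_sum_of_isPoleOf hP₀ ht₀ htx₀ htz₀ p hp0
  refine ⟨m * q.natDegree - (m * (p j).natDegree + r * j), fun P hP t ht htx htz => ?_⟩
  obtain ⟨l, hl, hl0, ho, hmin'⟩ := h.exists_ord_sum_of_isPoleOf hP ht htx htz p hp0
  have heq : ((m * (p l).natDegree + r * l : ℕ) : ℤ) = (m * (p j).natDegree + r * j : ℕ) :=
    congrArg _ (le_antisymm (hmin l hl hl0) (hmin' j hj hj0))
  push_cast at heq
  rw [← hp, P.ord_mul (h.aeval_ne_zero hq) hu, P.ord_aeval_of_pole hP hq, htx] at ho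
  linear_combination ho - t * heq

theorem ord_of_isPoleOf (hP : P.IsPoleOf x) : P.ord x = -m ∧ P.ord z = -r := by
  obtain ⟨t, ht, htx, htz⟩ := h.exists_ord_of_isPoleOf hP
  obtain ⟨u, hu, hu1⟩ := P.exists_ord_eq_one
  obtain ⟨n, hn⟩ := h.exists_ord_eq_of_isPoleOf hu
  have h1 := hn P hP t ht htx htz
  rw [hu1] at h1
  have : t = 1 := Int.eq_one_of_dvd_one ht.le ⟨n, by rw [h1]; ring⟩
  simpa [this] using And.intro htx htz

theorem eq_of_isPoleOf {Q : Place k F} (hP : P.IsPoleOf x) (hQ : Q.IsPoleOf x) : P = Q := by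
  refine Place.ext_ord fun u hu => ?_
  obtain ⟨n, hn⟩ := h.exists_ord_eq_of_isPoleOf hu
  rw [hn P hP 1 one_pos (by simp [h.ord_of_isPoleOf hP]) (by simp [h.ord_of_isPoleOf hP]),
    hn Q hQ 1 one_pos (by simp [h.ord_of_isPoleOf hQ]) (by simp [h.ord_of_isPoleOf hQ])]

/-- The functions that are regular away from the pole of `x` form the ring `k[x, z]`. -/
theorem exists_eq_sum_of_regular {u : F} (hu0 : u ≠ 0)
    (hu : ∀ P : Place k F, ¬ P.IsPoleOf x → 0 ≤ P.ord u) :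
    ∃ p : ℕ → k[X], u = ∑ j ∈ Finset.range m, aeval x (p j) * z ^ j := by
  have := h.finiteDimensional
  have := h.isSeparable
  have hint : IsIntegral (Algebra.adjoin k {x}) u := by
    refine isIntegral_adjoin_of_forall_place h.transcendental fun P hP => ?_
    rw [P.val_le_one_iff hu0]
    refine hu P fun hx => ?_
    rw [P.val_le_one_iff hx.1] at hP
    have := hx.2
    omega
  obtain ⟨p, hp⟩ := h.exists_sum_of_isIntegral hint
  -- At a zero of x - α_i, f = z^m has order m, so f^(m-1) u has order at least m(m - 1). Without
  -- cancellation every nonzero term satisfies m · mult + j ≥ m(m - 1), and j < m forces mult ≥ m -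
  -- 1.
  have hdvd (j : ℕ) (hj : j < m) : (∏ i, (X - C (α i))) ^ (m - 1) ∣ p j := by
    by_cases hpj : p j = 0
    · simp [hpj]
    rw [← Finset.prod_pow]
    refine Finset.prod_dvd_of_coprime (fun i _ i' _ hii' => ?_) fun i _ => ?_
    · exact (pairwise_coprime_X_sub_C h.injective hii').pow
    · rw [← le_rootMultiplicity_iff hpj]
      obtain ⟨P, hP⟩ := h.exists_isZeroOf_sub (α i)
      obtain ⟨l, hl, hl0, -, ho, hmin⟩ := h.exists_ord_sum_of_isZeroOf hP p ⟨j, hj, hpj⟩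
      have h1 := hmin j hj hpj
      have h2 := hu P (P.not_isPoleOf_of_isZeroOf hP)
      rw [← hp, P.ord_mul (pow_ne_zero _ h.prod_ne_zero) hu0, P.ord_pow, ← h.pow_eq, P.ord_pow,
        h.ord_z_eq_one hP] at ho
      by_contra! hlt
      have h3 : m * ((p j).rootMultiplicity (α i) + 1) ≤ m * (m - 1) := Nat.mul_le_mul_left _ hlt
      have h4 : ((m - 1 : ℕ) : ℤ) * m ≤ (m * (p l).rootMultiplicity (α i) + l : ℕ) := by
        push_cast
        linarith
      have h5 : (m - 1) * m ≤ m * (p l).rootMultiplicity (α i) + l := by exact_mod_cast h4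
      linarith
  choose! q hq using hdvd
  refine ⟨q, mul_left_cancel₀ (pow_ne_zero (m - 1) h.prod_ne_zero) ?_⟩
  rw [hp, Finset.mul_sum]
  refine Finset.sum_congr rfl fun j hj => ?_
  rw [hq j (Finset.mem_range.1 hj)]
  simp [mul_assoc]

/-! ### The semigroups at P_∞ and at P_i. -/

theorem weierstrassSemigroup_of_isPoleOf (hP : P.IsPoleOf x) : weierstrassSemigroup P =
    {n : ℕ | ∃ j l : ℤ, 0 ≤ j ∧ j ≤ (m : ℤ) - 1 ∧ 0 ≤ l ∧ (n : ℤ) = m * l + r * j} := by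
  obtain ⟨hPx, hPz⟩ := h.ord_of_isPoleOf hP
  ext n
  constructor
  · rintro ⟨u, hu0, hu⟩
    -- Only for n > 0 does the truncation at 0 in `IsPoleDivisor` determine the order at P.
    rcases Nat.eq_zero_or_pos n with rfl | hn
    · exact ⟨0, 0, le_rfl, by have := h.m_pos; omega, le_rfl, by simp⟩
    obtain ⟨p, hp⟩ := h.exists_eq_sum_of_regular hu0 fun Q hQ => by
      have h1 := hu Q
      rw [Finsupp.single_eq_of_ne (by rintro rfl; exact hQ hP)] at h1
      omega
    obtain ⟨j, hj, -, ho, -⟩ := h.exists_ord_sum_of_isPoleOf hP (t := 1) one_pos (by simp [hPx])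
      (by simp [hPz]) p (exists_ne_zero_of_sum_ne_zero (hp ▸ hu0))
    rw [← hp] at ho
    have h1 := hu P
    rw [Finsupp.single_eq_same, ho] at h1
    exact ⟨j, (p j).natDegree, by omega, by omega, by omega, by omega⟩
  · rintro ⟨j, l, hj0, hjm, hl0, hn⟩
    have hx0 : x ^ l ≠ 0 := zpow_ne_zero _ h.x_ne_zero
    have hz0 : z ^ j ≠ 0 := zpow_ne_zero _ h.z_ne_zero
    refine ⟨x ^ l * z ^ j, mul_ne_zero hx0 hz0, fun Q => ?_⟩
    rw [Q.ord_mul hx0 hz0, Q.ord_zpow, Q.ord_zpow]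
    by_cases hQ : Q = P
    · subst hQ
      rw [Finsupp.single_eq_same, hPx, hPz, max_eq_left] <;> linarith
    · have hQx : ¬ Q.IsPoleOf x := fun h1 => hQ (h.eq_of_isPoleOf h1 hP)
      rw [Finsupp.single_eq_of_ne hQ, max_eq_right]
      have h1 := h.ord_z_nonneg hQx
      have h2 : 0 ≤ Q.ord x := by simpa using h.ord_sub_nonneg hQx 0
      have := mul_nonneg hl0 h2
      have := mul_nonneg hj0 h1
      linarith

/-- Multiplication by (x - α_i)^n removes the pole of u at P and leaves a sum Σ p_j(x) z^j. The term
that gives its order at P supplies j, and e is its root multiplicity minus n. Regularity of u at the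
pole of x yields me + rj ≤ 0. -/
theorem weierstrassSemigroup_of_isZeroOf {i : Fin r}
    (hP : P.IsZeroOf (x - algebraMap k F (α i))) : weierstrassSemigroup P =
      {a : ℕ | ∃ e j : ℤ, 0 ≤ j ∧ j < m ∧ m * e + r * j ≤ 0 ∧ (a : ℤ) = -(m * e + j)} := by
  have hPz := h.ord_z_eq_one hP
  have hPx := h.ord_sub_eq_of_isZeroOf hP
  rw [hPz, mul_one] at hPx
  obtain ⟨Q, hQ⟩ := h.exists_isPoleOf
  have hx0 := h.x_sub_ne_zero (α i)
  ext n
  constructor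
  · rintro ⟨u, hu0, hu⟩
    rcases Nat.eq_zero_or_pos n with rfl | hn
    · exact ⟨0, 0, le_rfl, h.m_pos, by simp, by simp⟩
    have hPu : P.ord u = -n := by
      have h1 := hu P
      rw [Finsupp.single_eq_same] at h1
      omega
    have hQu (Q : Place k F) (hQP : Q ≠ P) : 0 ≤ Q.ord u := by
      have h1 := hu Q
      rw [Finsupp.single_eq_of_ne hQP] at h1
      omega
    have hv0 : (x - algebraMap k F (α i)) ^ n * u ≠ 0 := mul_ne_zero (pow_ne_zero _ hx0) hu0
    have hord (Q : Place k F) : Q.ord ((x - algebraMap k F (α i)) ^ n * u) =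
        n * Q.ord (x - algebraMap k F (α i)) + Q.ord u := by
      rw [Q.ord_mul (pow_ne_zero _ hx0) hu0, Q.ord_pow]
    obtain ⟨p, hp⟩ := h.exists_eq_sum_of_regular hv0 fun Q' hQ' => by
      rw [hord]
      by_cases hQP : Q' = P
      · rw [hQP, hPx, hPu]
        nlinarith [h.m_pos]
      · have := mul_nonneg (Int.natCast_nonneg n) (h.ord_sub_nonneg hQ' (α i))
        linarith [hQu Q' hQP]
    have hp0 := exists_ne_zero_of_sum_ne_zero (hp ▸ hv0)
    obtain ⟨j, hj, hj0, -, ho, -⟩ := h.exists_ord_sum_of_isZeroOf hP p hp0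
    obtain ⟨hQx, hQz⟩ := h.ord_of_isPoleOf hQ
    obtain ⟨l, -, -, hoQ, hmin⟩ := h.exists_ord_sum_of_isPoleOf hQ (t := 1) one_pos (by simp [hQx])
      (by simp [hQz]) p hp0
    rw [← hp, hord, hPx, hPu, hPz] at ho
    rw [← hp, hord, Q.ord_sub_of_isPoleOf hQ, hQx] at hoQ
    have h1 := hQu Q (by rintro rfl; exact Q.not_isPoleOf_of_isZeroOf hP hQ)
    -- Term j decides the order at P and term l the order at infinity. The pole order of term j is
    -- at most that of term l, hence at most mn, and a root multiplicity is at most the degree.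
    have h2 : ((m * (p j).natDegree + r * j : ℕ) : ℤ) ≤ (m * (p l).natDegree + r * l : ℕ) := by
      exact_mod_cast hmin j hj hj0
    have h3 : (m : ℤ) * (p j).rootMultiplicity (α i) ≤ m * (p j).natDegree := by
      gcongr
      simpa using natDegree_le_of_dvd (pow_rootMultiplicity_dvd (p j) (α i)) hj0
    push_cast at h2
    exact ⟨(p j).rootMultiplicity (α i) - n, j, by omega, by omega, by linarith, by linarith⟩
  · rintro ⟨e, j, hj0, hjm, he, hn⟩
    have hxe : (x - algebraMap k F (α i)) ^ e ≠ 0 := zpow_ne_zero _ hx0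
    have hz0 : z ^ j ≠ 0 := zpow_ne_zero _ h.z_ne_zero
    refine ⟨(x - algebraMap k F (α i)) ^ e * z ^ j, mul_ne_zero hxe hz0, fun Q' => ?_⟩
    rw [Q'.ord_mul hxe hz0, Q'.ord_zpow, Q'.ord_zpow]
    by_cases hQP : Q' = P
    · subst hQP
      rw [Finsupp.single_eq_same, hPx, hPz, max_eq_left] <;> linarith
    · rw [Finsupp.single_eq_of_ne hQP, max_eq_right]
      by_cases hQx : Q'.IsPoleOf x
      · obtain ⟨h1, h2⟩ := h.ord_of_isPoleOf hQx
        rw [Q'.ord_sub_of_isPoleOf hQx, h1, h2]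
        linarith
      · have h1 : Q'.ord (x - algebraMap k F (α i)) = 0 := by
          have h2 := h.ord_sub_nonneg hQx (α i)
          by_contra hcon
          exact hQP (h.eq_of_isZeroOf ⟨hx0, by omega⟩ hP)
        have := mul_nonneg hj0 (h.ord_z_nonneg hQx)
        rw [h1]
        linarith

end IsSuperelliptic

/-! ### Reduction to exponent 1 and conclusion. -/

/-- Replacing `y` by a suitable product of powers of `y` and of the radicand turns the equation
`y ^ m = ∏ i, (x - α i) ^ lam` into `z ^ m = ∏ i, (x - α i)`. -/
theorem exists_isSuperelliptic {k F : Type*} [Field k] [Field F] [Algebra k F]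
    {m r : ℕ} {lam : ℤ} (hm : 2 ≤ m) (hmk : (m : k) ≠ 0)
    (hmr : Int.gcd (m : ℤ) ((r : ℤ) * lam) = 1)
    {α : Fin r → k} (hα : Function.Injective α) {x y : F} (hx : Transcendental k x)
    (hy : y ^ m = ∏ i, (x - algebraMap k F (α i)) ^ lam)
    (hF : IntermediateField.adjoin k {x, y} = ⊤) : ∃ z, IsSuperelliptic m α x z := by
  rw [← Int.isCoprime_iff_gcd_eq_one] at hmr
  have hf0 : ∏ i, (x - algebraMap k F (α i)) ≠ 0 := Finset.prod_ne_zero_iff.2 fun i _ h0 =>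
    hx.sub_algebraMap (α i) (h0 ▸ isAlgebraic_zero)
  rw [Finset.prod_zpow] at hy
  set f := ∏ i, (x - algebraMap k F (α i)) with hf
  have hy0 : y ≠ 0 := by
    rintro rfl
    rw [zero_pow (by omega)] at hy
    exact zpow_ne_zero lam hf0 hy.symm
  -- With bm + aλ = 1 and y^m = f^λ, the function z = y^a f^b satisfies both z^m = f and z^λ = y, so
  -- z and y generate the same field over k(x).
  obtain ⟨b, a, hab⟩ := hmr.of_mul_right_right
  have hzm : (y ^ a * f ^ b) ^ m = f := by
    rw [mul_pow, ← zpow_natCast, ← zpow_natCast, ← zpow_mul, mul_comm a, zpow_mul, zpow_natCast, hy,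
      ← zpow_mul, ← zpow_mul, ← zpow_add₀ hf0, mul_comm lam, add_comm, hab, zpow_one]
  have hzl : (y ^ a * f ^ b) ^ lam = y := by
    rw [mul_zpow, ← zpow_mul, ← zpow_mul, mul_comm b, zpow_mul f, ← hy, ← zpow_natCast, ← zpow_mul,
      ← zpow_add₀ hy0, mul_comm (m : ℤ), add_comm, hab, zpow_one]
  refine ⟨y ^ a * f ^ b, hm, hmk, Int.isCoprime_iff_gcd_eq_one.1 hmr.of_mul_right_left, hα, hx, hzm,
    ?_⟩
  rw [eq_top_iff, ← hF, IntermediateField.adjoin_le_iff]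
  rintro u (rfl | hu)
  · exact IntermediateField.subset_adjoin k _ (by simp)
  · rw [Set.mem_singleton_iff] at hu
    subst hu
    have hz := zpow_mem (IntermediateField.subset_adjoin k {x, u ^ a * f ^ b} (Or.inr rfl)) lam
    rwa [hzl] at hz

theorem corollary4p4 {k F : Type*} [Field k] [Finite k] [Field F] [Algebra k F]
    (p : ℕ) [CharP k p] (m r : ℕ) (lam : ℤ)
    (hm : 2 ≤ m) (hpm : Nat.gcd p m = 1) (hmr : Int.gcd (m : ℤ) ((r : ℤ) * lam) = 1)
    (α : Fin r → k) (hα : Function.Injective α)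
    (x y : F) (hx : Transcendental k x)
    (hy : y ^ m = ∏ i, (x - algebraMap k F (α i)) ^ lam)
    (hF : IntermediateField.adjoin k {x, y} = ⊤) :
    ∃ (P : Fin r → Place k F) (Pinf : Place k F),
      (∀ (i : Fin r) (Q : Place k F), Q.IsZeroOf (x - algebraMap k F (α i)) ↔ Q = P i) ∧
      (∀ Q : Place k F, Q.IsPoleOf x ↔ Q = Pinf) ∧
      (∀ i : Fin r, weierstrassSemigroup (P i) =
        {a : ℕ | -(r : ℤ) * a + m * ((r : ℤ) - 1) * ⌈(a : ℚ) / m⌉ ≤ 0}) ∧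
      (weierstrassSemigroup Pinf =
        {n : ℕ | ∃ j l : ℤ, 0 ≤ j ∧ j ≤ (m : ℤ) - 1 ∧ 0 ≤ l ∧ (n : ℤ) = m * l + r * j}) ∧
      (∀ i : Fin r, weierstrassGaps (P i) =
        {n : ℕ | 0 < n ∧ ∃ j l : ℤ, 1 ≤ j ∧ j ≤ (m : ℤ) - 1 - ⌊(m : ℚ) / r⌋ ∧
          0 ≤ l ∧ l ≤ (r : ℤ) - 2 - ⌊(r : ℚ) * j / m⌋ ∧ (n : ℤ) = m * l + j}) ∧
      (weierstrassGaps Pinf =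
        {n : ℕ | 0 < n ∧ ∃ j l : ℤ, 1 ≤ j ∧ j ≤ (m : ℤ) - 1 - ⌊(m : ℚ) / r⌋ ∧
          ⌈(r : ℚ) * j / m⌉ ≤ l ∧ l ≤ (r : ℤ) - 1 ∧ (n : ℤ) = m * l - r * j}) := by
  have hmk : (m : k) ≠ 0 := fun h0 => CharP.char_ne_one k p
    (Nat.eq_one_of_dvd_one (hpm ▸ Nat.dvd_gcd dvd_rfl ((CharP.cast_eq_zero_iff k p m).1 h0)))
  obtain ⟨z, h⟩ := exists_isSuperelliptic hm hmk hmr hα hx hy hF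
  choose P hP using fun i => h.exists_isZeroOf_sub (α i)
  obtain ⟨Pinf, hPinf⟩ := h.exists_isPoleOf
  have hH (i : Fin r) : weierstrassSemigroup (P i) =
      {a : ℕ | -(r : ℤ) * a + m * ((r : ℤ) - 1) * ⌈(a : ℚ) / m⌉ ≤ 0} := by
    rw [h.weierstrassSemigroup_of_isZeroOf (hP i)]
    ext a
    exact (mem_affine_semigroup_iff (by omega) a).symm
  have hHinf := h.weierstrassSemigroup_of_isPoleOf hPinf
  refine ⟨P, Pinf, fun i Q => ⟨fun hQ => h.eq_of_isZeroOf hQ (hP i), fun hQ => hQ ▸ hP i⟩,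
    fun Q => ⟨fun hQ => h.eq_of_isPoleOf hQ hPinf, fun hQ => hQ ▸ hPinf⟩, hH, hHinf, fun i => ?_, ?_⟩
  · rw [weierstrassGaps, hH, affine_gaps_eq (by omega) h.r_pos]
  · rw [weierstrassGaps, hHinf, infinity_gaps_eq hm h.r_pos h.gcd_eq_one]
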